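/- Let $F$ be a field of characteristic different from $2$ with $|F^\ast/F^{\ast 2}|=2^d$. Let $p(F)$ be its Pythagoras number, i.e. the least $k$ such that every sum of squares in $F$ is a sum of $k$ squares, let $s\ge 0$ be the integer with $2^s\le p(F)<2^{s+1}$, and let $n\ge 1$ be an integer. Write $IF$ for the fundamental ideal of the Witt ring of $F$ and $I^nF=(IF)^n$; denote the Witt class of a form again by the form. An $n$-fold Pfister form is a form $\langle\langle a_1,\dots,a_n\rangle\rangle=\langle 1,a_1\rangle\otimes\cdots\otimes\langle 1,a_n\rangle$ with slots $a_i\in F^\ast$; let $P_n(F)$ be the set of isometry classes of such forms. For $0\le m\le n$ let $P_{n,m}(F)\subseteq P_n(F)$ be the set of classes of anisotropic forms that can be written with $m$ slots equal to $1$ but not with $m+1$ slots equal to $1$. Let $D_F(2^m)$ be the group of nonzero sums of $2^m$ squares in $F$, and $d_m=\dim_{\mathbb F_2}F^\ast/\pm D_F(2^m)$. The field $F$ is nonreal if $-1$ is a sum of squares in $F$. Then for every $\varphi\in I^nF$ there is a finite subset $P\subseteq P_n(F)$ with $$\varphi\equiv\sum_{\pi\in P}\pi \mod I^{n+1}F$$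 such that, for all $0\le m\le n$ simultaneously, the number $|P\cap P_{n,m}(F)|$ is - equal to $0$ if $F$ is nonreal and $m>s$; - at most $1$ if $n-m\ge d_m-1$ and, in case $F$ is nonreal, moreover $m\le s$; - in all other cases at most $$\left\lfloor\frac{\#\{\text{subspaces of dimension } n-m+1 \text{ in } F^\ast/F^{\ast 2}\}}{2^{d-n+m}-1}\right\rfloor\le\left\lfloor\frac{2^{(n-m+1)(d-n+m)}}{2^{d-n+m}-1}\right\rfloor .$$ -/

import Mathlib

namespace SymbolLength

variable (F : Type*) [Field F]

/-! ### Diagonal forms and isometry classes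

Over a field of characteristic different from 2 every finite dimensional non-degenerate quadratic
form is isometric to a diagonal form with nonzero entries; such a form is given by the list of its
entries. -/

variable {F} in
/-- The quadratic form `⟨a₁, …, aₖ⟩` on `Fᵏ`, for a list `[a₁, …, aₖ]` of nonzero elements. -/
def diag (a : List Fˣ) : QuadraticForm F (Fin a.length → F) :=
  QuadraticMap.weightedSumSquares F (fun i => ((a.get i : Fˣ) : F))

/-- Isometry of diagonal forms. -/
def isometrySetoid : Setoid (List Fˣ) where
  r a b := (diag a).Equivalent (diag b)
  iseqv := ⟨fun _ => QuadraticMap.Equivalent.refl _, fun h => h.symm, fun h k => h.trans k⟩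

/-- Isometry classes of finite dimensional non-degenerate quadratic forms over `F`. -/
def IsoClass : Type _ := Quotient (isometrySetoid F)

variable {F} in
/-- The isometry class of `⟨a₁, …, aₖ⟩`. -/
def isoClass (a : List Fˣ) : IsoClass F := Quotient.mk (isometrySetoid F) a

variable {F} in
/-- A class is anisotropic if it is the class of an anisotropic form. -/
def IsoClass.Anisotropic (c : IsoClass F) : Prop :=
  ∃ a : List Fˣ, isoClass a = c ∧ (diag a).Anisotropic

/-! ### The Witt ring -/

variable {F} in
/-- The element `a₁ + ⋯ + aₖ` of the group ring `ℤ[Fˣ]`. -/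
noncomputable def formal (a : List Fˣ) : MonoidAlgebra ℤ Fˣ :=
  (a.map (fun x => MonoidAlgebra.of ℤ Fˣ x)).sum

/-- The relations of the Witt ring: isometric forms are identified, and the hyperbolic plane
`⟨1, -1⟩` is set to zero. -/
noncomputable def wittRelations : Ideal (MonoidAlgebra ℤ Fˣ) :=
  Ideal.span ({x | ∃ a b : List Fˣ, (diag a).Equivalent (diag b) ∧ x = formal a - formal b}
    ∪ {formal [1, -1]})

/-- The Witt ring of `F`: the Grothendieck ring of the isometry classes of forms, modulo the ideal
generated by the hyperbolic plane. The free abelian group on the one-dimensional forms `⟨a⟩` is the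
group ring `ℤ[Fˣ]`, in which addition stands for the orthogonal sum and the product for the tensor
product, `⟨a⟩ ⊗ ⟨b⟩ = ⟨ab⟩`; the Grothendieck ring is its quotient by all differences of isometric
forms. -/
abbrev WittRing : Type _ := MonoidAlgebra ℤ Fˣ ⧸ wittRelations F

variable {F} in
/-- The Witt class of an isometry class of forms. -/
noncomputable def IsoClass.witt (c : IsoClass F) : WittRing F :=
  Quotient.lift (s := isometrySetoid F)
    (fun a : List Fˣ => Ideal.Quotient.mk (wittRelations F) (formal a))
    (fun a b h => Ideal.Quotient.eq.mpr
      (Ideal.subset_span (Or.inl ⟨a, b, h, rfl⟩))) c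

/-- The fundamental ideal `IF` of the Witt ring, of the classes of forms of even dimension. -/
noncomputable def fundamentalIdeal : Ideal (WittRing F) :=
  Ideal.span {w | ∃ a : List Fˣ, Even a.length ∧ w = (isoClass a).witt}

/-! ### Pfister forms -/

variable {F} in
/-- The tensor product `⟨a₁, …, aₖ⟩ ⊗ ⟨b₁, …, bₗ⟩ = ⟨a₁b₁, …, a₁bₗ, …, aₖb₁, …, aₖbₗ⟩`. -/
def tensor (a b : List Fˣ) : List Fˣ := a.flatMap (fun x => b.map (fun y => x * y))

variable {F} in
/-- The Pfister form `⟨⟨a₁, …, aₙ⟩⟩ = ⟨1, a₁⟩ ⊗ ⋯ ⊗ ⟨1, aₙ⟩`. -/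
def pfister : List Fˣ → List Fˣ
  | [] => [1]
  | a :: l => tensor [1, a] (pfister l)

/-- `P_n(F)`: the isometry classes of `n`-fold Pfister forms. -/
def pfisterClasses (n : ℕ) : Set (IsoClass F) :=
  {c | ∃ l : List Fˣ, l.length = n ∧ c = isoClass (pfister l)}

variable {F} in
/-- The class `c` can be written as an `n`-fold Pfister form with (at least) `m` slots that
are `1`. -/
def HasOnes (n m : ℕ) (c : IsoClass F) : Prop :=
  ∃ l : List Fˣ, m + l.length = n ∧ c = isoClass (pfister (List.replicate m 1 ++ l))

/-- `P_{n,m}(F)`: the classes of anisotropic `n`-fold Pfister forms that can be written with `m`,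
but not with `m + 1`, slots that are `1`. -/
def pfisterClassesWithOnes (n m : ℕ) : Set (IsoClass F) :=
  {c | c.Anisotropic ∧ HasOnes n m c ∧ ¬ HasOnes n (m + 1) c}

/-! ### Field invariants -/

/-- The Pythagoras number `p(F)`: the least `k` such that every sum of squares in `F` is a sum of
`k` squares (`⊤` if there is none). -/
noncomputable def pythagorasNumber : ℕ∞ :=
  sInf {p | ∃ k : ℕ, p = k ∧ ∀ x : F, IsSumSq x → ∃ y : Fin k → F, x = ∑ i, y i ^ 2}

/-- The subgroup of squares of `Fˣ`. -/
def squares : Subgroup Fˣ := (powMonoidHom 2 : Fˣ →* Fˣ).range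

/-- The subgroup `±D_F(2^m)` of `Fˣ`, generated by `-1` and `D_F(2^m)`, the set of nonzero sums of
`2^m` squares (which is itself a group, by a theorem of Pfister). -/
def plusMinusD (m : ℕ) : Subgroup Fˣ :=
  Subgroup.closure ({x | ∃ y : Fin (2 ^ m) → F, (x : F) = ∑ i, y i ^ 2} ∪ {-1})

/-- `Fˣ/Fˣ²`, written additively. -/
abbrev SquareClassSpace : Type _ := Additive (Fˣ ⧸ squares F)

/-- `Fˣ/±D_F(2^m)`, written additively. -/
abbrev PlusMinusSpace (m : ℕ) : Type _ := Additive (Fˣ ⧸ plusMinusD F m)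

theorem two_nsmul_squareClass (x : SquareClassSpace F) : 2 • x = 0 := by
  induction x using Additive.rec with | _ x
  obtain ⟨u, rfl⟩ := QuotientGroup.mk_surjective x
  rw [← ofMul_pow, ← QuotientGroup.mk_pow]
  exact congrArg Additive.ofMul ((QuotientGroup.eq_one_iff _).mpr ⟨u, rfl⟩)

theorem two_nsmul_plusMinus (m : ℕ) (x : PlusMinusSpace F m) : 2 • x = 0 := by
  induction x using Additive.rec with | _ x
  obtain ⟨u, rfl⟩ := QuotientGroup.mk_surjective x
  rw [← ofMul_pow, ← QuotientGroup.mk_pow]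
  refine congrArg Additive.ofMul ((QuotientGroup.eq_one_iff _).mpr
    (Subgroup.subset_closure (Or.inl ⟨Pi.single ⟨0, by positivity⟩ (u : F), ?_⟩)))
  rw [Finset.sum_eq_single (⟨0, by positivity⟩ : Fin (2 ^ m))]
  · simp
  · intro i _ hi
    rw [Pi.single_eq_of_ne hi]
    simp
  · simp

/-- The structure of an `𝔽₂`-vector space on `Fˣ/Fˣ²`. -/
noncomputable instance squareClassModule : Module (ZMod 2) (SquareClassSpace F) :=
  AddCommGroup.zmodModule (n := 2) (G := SquareClassSpace F) (two_nsmul_squareClass F)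

/-- The structure of an `𝔽₂`-vector space on `Fˣ/±D_F(2^m)`. -/
noncomputable instance plusMinusModule (m : ℕ) : Module (ZMod 2) (PlusMinusSpace F m) :=
  AddCommGroup.zmodModule (n := 2) (G := PlusMinusSpace F m) (two_nsmul_plusMinus F m)

/-- `d_m`, the dimension of `Fˣ/±D_F(2^m)` over `𝔽₂`. -/
noncomputable def dimPM (m : ℕ) : ℕ := Module.finrank (ZMod 2) (PlusMinusSpace F m)

/-- The number of `k`-dimensional subspaces of `Fˣ/Fˣ²`. -/
noncomputable def numSubspaces (k : ℕ) : ℕ :=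
  {U : Submodule (ZMod 2) (SquareClassSpace F) | Module.finrank (ZMod 2) U = k}.ncard

end SymbolLength

open Module

/-! Write `I` for the fundamental ideal and filter `I^n` by `onesIdeal n m = 2^m I^(n-m) + I^(n+1)`,
descending from `I^n` at `m = 0` to `I^(n+1)` at `m = n + 1`. At level `m` put `k = n - m`. Modulo
level `m + 1` the class of `2^m ⟨⟨-a₁, …, -aₖ⟩⟩` is an alternating `𝔽₂`-multilinear function of the
classes of the `aᵢ` in `Fˣ/±D_F(2^m)` (`symbolMap`). Such a function depends only on the span of its
arguments when these are independent, and vanishes otherwise. If the spans of two symbols together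
have dimension at most `k + 1`, they share a subspace of dimension `k - 1`, and the sum of the
symbols is again a symbol or zero (`AlternatingMap.add_eq_zero_or_exists_add_eq`).

Hence in a shortest representation at level `m` (`exists_minimal_finset`) any two spans together
have dimension at least `k + 2`. If `d_m ≤ k + 1` there is room for only one symbol. In general, no
subspace of dimension `k + 1` in `Fˣ/Fˣ²` contains two of the lifted spans, while each of them lies
in at least `2^(d-k) - 1` such subspaces; counting gives the bound (`card_mul_le_ncard_subspaces`).
For nonreal `F` and `m > s`, `2^m = 0` in the Witt ring, so level `m` contributes nothing. Passing
through the levels one after the other leaves a remainder in `I^(n+1)`, and a class in `P_{n,m}(F)`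
can only have been chosen at level `m`.

Only a few relations of the Witt ring enter, and `WittSystem` records them: additivity over diagonal
entries, multiplicativity on one-dimensional forms, `⟨-1⟩ = -1`, and generation by one-dimensional
forms. -/

/-! ### Alternating maps over `𝔽₂`. -/

theorem AlternatingMap.eq_det_smul {R M A ι : Type*} [CommRing R] [AddCommGroup M] [Module R M]
    [AddCommGroup A] [Module R A] [Fintype ι] [DecidableEq ι] (e : Basis ι R M)
    (f : M [⋀^ι]→ₗ[R] A) (v : ι → M) : f v = e.det v • f e := by
  have h : f = (LinearMap.toSpanSingleton R A (f e)).compAlternatingMap e.det := by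
    refine Basis.ext_alternating e fun w hw => ?_
    let σ : Equiv.Perm ι := Equiv.ofBijective w (Finite.injective_iff_bijective.1 hw)
    have h1 : (fun i => e (w i)) = e ∘ σ := rfl
    rw [h1, AlternatingMap.map_perm, AlternatingMap.map_perm]
    simp [Basis.det_self]
  rw [h]
  simp [Basis.det_self]

/-- The two families are bases of the same space, so the values differ by the determinant of a base
change. This is a unit of `𝔽₂`, hence `1`. -/
theorem AlternatingMap.eq_of_linearIndependent_of_mem_span {V A ι : Type*} [AddCommGroup V]
    [Module (ZMod 2) V] [AddCommGroup A] [Module (ZMod 2) A] [Fintype ι]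
    (f : V [⋀^ι]→ₗ[ZMod 2] A) {a b : ι → V} (ha : LinearIndependent (ZMod 2) a)
    (hb : LinearIndependent (ZMod 2) b) (h : ∀ i, b i ∈ Submodule.span (ZMod 2) (Set.range a)) :
    f b = f a := by
  classical
  let U := Submodule.span (ZMod 2) (Set.range a)
  let e : Basis ι (ZMod 2) U := Basis.span ha
  let b' : ι → U := fun i => ⟨b i, h i⟩
  have hb' : LinearIndependent (ZMod 2) b' := LinearIndependent.of_comp U.subtype hb
  have : FiniteDimensional (ZMod 2) U := e.finiteDimensional_of_finite
  let e' : Basis ι (ZMod 2) U :=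
    basisOfLinearIndependentOfCardEqFinrank' b' hb' (Module.finrank_eq_card_basis e).symm
  have h1 := AlternatingMap.eq_det_smul e (f.compLinearMap U.subtype) b'
  have h2 : e.det b' = 1 := by
    have h3 : IsUnit (e.det e') := e.isUnit_det e'
    have h4 : (e' : ι → U) = b' := by simp [e']
    rw [h4] at h3
    have : ∀ x : ZMod 2, IsUnit x → x = 1 := by decide
    exact this _ h3
  rw [h2, one_smul] at h1
  have h5 : ∀ i, (e i : V) = a i := fun i => congrArg Subtype.val (Basis.span_apply ha i)
  simpa [AlternatingMap.compLinearMap_apply, b', h5] using h1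

/-- Two `k`-dimensional spans inside a space of dimension `k + 1` share `k - 1` independent vectors
`e`. Completing `e` to a basis of each span turns the sum into `f (x, e) + f (y, e) = f (x + y, e)`.
-/
theorem AlternatingMap.add_eq_zero_or_exists_add_eq {V A : Type*} [AddCommGroup V]
    [Module (ZMod 2) V] [FiniteDimensional (ZMod 2) V] [AddCommGroup A] [Module (ZMod 2) A]
    {k : ℕ} (f : V [⋀^Fin k]→ₗ[ZMod 2] A) (a b : Fin k → V)
    (h : finrank (ZMod 2) ↥(Submodule.span (ZMod 2) (Set.range a) ⊔
      Submodule.span (ZMod 2) (Set.range b)) ≤ k + 1) :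
    f a + f b = 0 ∨ ∃ c, f a + f b = f c := by
  by_cases ha : LinearIndependent (ZMod 2) a
  swap
  · exact Or.inr ⟨b, by rw [f.map_linearDependent a ha, zero_add]⟩
  by_cases hb : LinearIndependent (ZMod 2) b
  swap
  · exact Or.inr ⟨a, by rw [f.map_linearDependent b hb, add_zero]⟩
  cases k with
  | zero =>
    -- Without arguments there is nothing to merge: both values are the same constant, and their sum
    -- is zero. This is the reason for the first alternative.
    left
    rw [Subsingleton.elim b a, ← two_smul (ZMod 2), show (2 : ZMod 2) = 0 from rfl, zero_smul]
  | succ k =>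
    right
    set S := Submodule.span (ZMod 2) (Set.range a) with hS
    set T := Submodule.span (ZMod 2) (Set.range b) with hT
    have hSf : finrank (ZMod 2) S = k + 1 := by simpa using finrank_span_eq_card ha
    have hTf : finrank (ZMod 2) T = k + 1 := by simpa using finrank_span_eq_card hb
    have hi := Submodule.finrank_sup_add_finrank_inf_eq S T
    obtain ⟨e', he'⟩ := exists_linearIndependent_of_le_finrank
      (show k ≤ finrank (ZMod 2) ↥(S ⊓ T) by omega)
    let e : Fin k → V := fun i => e' i
    have he : LinearIndependent (ZMod 2) e :=
      he'.map' (S ⊓ T).subtype (Submodule.ker_subtype _)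
    have key : ∀ U : Submodule (ZMod 2) V, finrank (ZMod 2) U = k + 1 →
        ∃ x ∈ U, LinearIndependent (ZMod 2) (Fin.cons x e : Fin (k + 1) → V) := by
      intro U hU
      by_contra! hcon
      have hle : U ≤ Submodule.span (ZMod 2) (Set.range e) := fun x hx => by
        by_contra hxe
        exact hcon x hx (linearIndependent_finCons.2 ⟨he, hxe⟩)
      have h1 := Submodule.finrank_mono hle
      rw [finrank_span_eq_card he, Fintype.card_fin] at h1
      omega
    obtain ⟨x, hx, hxe⟩ := key S hSf
    obtain ⟨y, hy, hye⟩ := key T hTf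
    refine ⟨Fin.cons (x + y) e, ?_⟩
    rw [← f.eq_of_linearIndependent_of_mem_span ha hxe,
      ← f.eq_of_linearIndependent_of_mem_span hb hye]
    · exact (f.toMultilinearMap.cons_add e x y).symm
    · refine Fin.cases (by simpa using hy) fun i => ?_
      simpa using (e' i).2.2
    · refine Fin.cases (by simpa using hx) fun i => ?_
      simpa using (e' i).2.1

/-! ### Counting subspaces over `𝔽₂`. -/

/-- A subspace `U` of `V` lies in at least `2 ^ (dim V - dim U) - 1` subspaces of dimension
`dim U + 1`. -/
theorem pow_sub_one_le_ncard_covers {V : Type*} [AddCommGroup V] [Module (ZMod 2) V] [Finite V]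
    (U : Submodule (ZMod 2) V) :
    2 ^ (finrank (ZMod 2) V - finrank (ZMod 2) U) - 1 ≤
      {W : Submodule (ZMod 2) V | U ≤ W ∧ finrank (ZMod 2) W = finrank (ZMod 2) U + 1}.ncard := by
  have : Module.Finite (ZMod 2) V := Module.Finite.of_finite
  have : Finite (Submodule (ZMod 2) V) := Finite.of_injective _ SetLike.coe_injective
  have : Finite (V ⧸ U) := Finite.of_surjective _ U.mkQ_surjective
  have hq := U.finrank_quotient_add_finrank
  have hc : Nat.card (V ⧸ U) = 2 ^ (finrank (ZMod 2) V - finrank (ZMod 2) U) := by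
    rw [Module.natCard_eq_pow_finrank (K := ZMod 2), Nat.card_zmod]
    congr 1
    omega
  have h0 : ({0}ᶜ : Set (V ⧸ U)).ncard = 2 ^ (finrank (ZMod 2) V - finrank (ZMod 2) U) - 1 := by
    rw [Set.ncard_compl, hc, Set.ncard_singleton]
  rw [← h0]
  -- The preimages of the lines of `V ⧸ U` are such subspaces, and over `𝔽₂` a line has exactly one
  -- nonzero vector.
  refine Set.ncard_le_ncard_of_injOn
    (fun x => (Submodule.span (ZMod 2) {x}).comap U.mkQ) ?_ ?_ (Set.toFinite _)
  · intro x hx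
    have hx : x ≠ 0 := hx
    have hle : U ≤ (Submodule.span (ZMod 2) {x}).comap U.mkQ := by
      intro u hu
      simp [(Submodule.Quotient.mk_eq_zero U).2 hu]
    refine ⟨hle, ?_⟩
    set W := (Submodule.span (ZMod 2) {x}).comap U.mkQ with hW
    have h1 := (U.mkQ.comp W.subtype).finrank_range_add_finrank_ker
    rw [LinearMap.range_comp, Submodule.range_subtype, hW,
      Submodule.map_comap_eq_of_surjective U.mkQ_surjective, ← hW, finrank_span_singleton hx,
      LinearMap.ker_comp, Submodule.ker_mkQ,
      (Submodule.comapSubtypeEquivOfLe hle).finrank_eq] at h1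
    omega
  · intro x hx y hy hxy
    have h1 : Submodule.span (ZMod 2) {x} = Submodule.span (ZMod 2) {y} :=
      Submodule.comap_injective_of_surjective U.mkQ_surjective hxy
    have h2 : x ∈ Submodule.span (ZMod 2) {y} := h1 ▸ Submodule.mem_span_singleton_self x
    obtain ⟨c, rfl⟩ := Submodule.mem_span_singleton.1 h2
    have : ∀ c : ZMod 2, c = 0 ∨ c = 1 := by decide
    rcases this c with rfl | rfl
    · exact absurd (zero_smul _ _) hx
    · exact one_smul _ _

/-- A subspace of dimension `k + 1` containing both `U i` and `U j` would contain their sum, which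
is too large. So the families of `(k + 1)`-dimensional subspaces above the various `U i` are
disjoint. -/
theorem card_mul_le_ncard_subspaces {V ι : Type*} [AddCommGroup V] [Module (ZMod 2) V] [Finite V]
    {k : ℕ} (s : Finset ι) (U : ι → Submodule (ZMod 2) V)
    (hU : ∀ i ∈ s, finrank (ZMod 2) (U i) = k)
    (h : ∀ i ∈ s, ∀ j ∈ s, i ≠ j → k + 1 < finrank (ZMod 2) ↥(U i ⊔ U j)) :
    s.card * (2 ^ (finrank (ZMod 2) V - k) - 1) ≤
      {W : Submodule (ZMod 2) V | finrank (ZMod 2) W = k + 1}.ncard := by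
  classical
  have : Module.Finite (ZMod 2) V := Module.Finite.of_finite
  have : Finite (Submodule (ZMod 2) V) := Finite.of_injective _ SetLike.coe_injective
  have := Fintype.ofFinite (Submodule (ZMod 2) V)
  let C : ι → Finset (Submodule (ZMod 2) V) := fun i =>
    Finset.univ.filter fun W => U i ≤ W ∧ finrank (ZMod 2) W = k + 1
  have hC : ∀ i ∈ s, 2 ^ (finrank (ZMod 2) V - k) - 1 ≤ (C i).card := by
    intro i hi
    have h1 := pow_sub_one_le_ncard_covers (U i)
    rw [hU i hi] at h1
    rw [← Set.ncard_coe_finset]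
    simpa [C] using h1
  have hd : Set.PairwiseDisjoint (s : Set ι) C := by
    intro i hi j hj hij
    refine Finset.disjoint_left.2 fun W h1 h2 => ?_
    simp only [C, Finset.mem_filter, Finset.mem_univ, true_and] at h1 h2
    have h3 := Submodule.finrank_mono (sup_le h1.1 h2.1)
    have h4 := h i hi j hj hij
    omega
  calc s.card * (2 ^ (finrank (ZMod 2) V - k) - 1)
      ≤ ∑ i ∈ s, (C i).card := by
        rw [← smul_eq_mul]; exact Finset.card_nsmul_le_sum s _ _ hC
    _ = (s.biUnion C).card := (Finset.card_biUnion hd).symm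
    _ ≤ _ := by
      rw [← Set.ncard_coe_finset]
      refine Set.ncard_le_ncard (fun W hW => ?_) (Set.toFinite _)
      simp only [C, Finset.coe_biUnion, Set.mem_iUnion, Finset.mem_coe, Finset.mem_filter] at hW
      obtain ⟨i, -, -, -, h1⟩ := hW
      exact h1

/-- Each subspace of dimension `r` is spanned by `∏ (2^r - 2^i)` independent `r`-tuples, and there
are `∏ (2^d - 2^i)` such tuples in `V`. The products are compared factor by factor: `2^d - 2^i ≤
2^(d-r+1) (2^r - 2^i)`, because `i < r`. -/
theorem ncard_subspaces_le {V : Type*} [AddCommGroup V] [Module (ZMod 2) V] [Finite V] {r : ℕ}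
    (hr : r ≤ finrank (ZMod 2) V) :
    {W : Submodule (ZMod 2) V | finrank (ZMod 2) W = r}.ncard ≤
      2 ^ (r * (finrank (ZMod 2) V - r + 1)) := by
  classical
  have : Module.Finite (ZMod 2) V := Module.Finite.of_finite
  have : Finite (Submodule (ZMod 2) V) := Finite.of_injective _ SetLike.coe_injective
  set d := finrank (ZMod 2) V with hd
  set N := {W : Submodule (ZMod 2) V | finrank (ZMod 2) W = r} with hN
  have hpos : 0 < ∏ i : Fin r, (2 ^ r - 2 ^ (i : ℕ)) := Finset.prod_pos fun i _ =>
    Nat.sub_pos_of_lt (Nat.pow_lt_pow_right (by norm_num) i.2)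
  refine Nat.le_of_mul_le_mul_right ?_ hpos
  have h1 : N.ncard * ∏ i : Fin r, (2 ^ r - 2 ^ (i : ℕ)) ≤ ∏ i : Fin r, (2 ^ d - 2 ^ (i : ℕ)) := by
    have hV : Nat.card { s : Fin r → V // LinearIndependent (ZMod 2) s } =
        ∏ i : Fin r, (2 ^ d - 2 ^ (i : ℕ)) := by
      have := card_linearIndependent (K := ZMod 2) (V := V) hr
      simpa [ZMod.card] using this
    have hW : ∀ W : N, Nat.card { s : Fin r → W.1 // LinearIndependent (ZMod 2) s } =
        ∏ i : Fin r, (2 ^ r - 2 ^ (i : ℕ)) := by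
      intro W
      have := card_linearIndependent (K := ZMod 2) (V := W.1) (k := r) W.2.ge
      rw [show finrank (ZMod 2) W.1 = r from W.2] at this
      simpa [ZMod.card] using this
    have := Fintype.ofFinite N
    rw [← hV]
    have hS : Nat.card (Σ W : N, { s : Fin r → W.1 // LinearIndependent (ZMod 2) s }) =
        N.ncard * ∏ i : Fin r, (2 ^ r - 2 ^ (i : ℕ)) := by
      rw [Nat.card_sigma, Finset.sum_congr rfl fun W _ => hW W]
      rw [Finset.sum_const, Finset.card_univ, smul_eq_mul, ← Nat.card_eq_fintype_card,
        Nat.card_coe_set_eq]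
    rw [← hS]
    refine Nat.card_le_card_of_injective
      (fun p => ⟨fun i => (p.2.1 i : V),
        p.2.2.map' p.1.1.subtype (Submodule.ker_subtype _)⟩) ?_
    rintro ⟨⟨W, hW⟩, s, hs⟩ ⟨⟨W', hW'⟩, s', hs'⟩ heq
    have hfun : (fun i => (s i : V)) = fun i => (s' i : V) := congrArg Subtype.val heq
    have hspan : ∀ (W : Submodule (ZMod 2) V) (_ : finrank (ZMod 2) W = r) (s : Fin r → W)
        (_ : LinearIndependent (ZMod 2) s),
        Submodule.span (ZMod 2) (Set.range fun i => (s i : V)) = W := by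
      intro W hW s hs
      refine Submodule.eq_of_le_of_finrank_eq
        (Submodule.span_le.2 (Set.range_subset_iff.2 fun i => (s i).2)) ?_
      have h2 := finrank_span_eq_card (hs.map' W.subtype (Submodule.ker_subtype _))
      rw [Fintype.card_fin] at h2
      exact h2.trans hW.symm
    have hWW : W = W' := by
      rw [← hspan W hW s hs, ← hspan W' hW' s' hs', hfun]
    subst hWW
    have : s = s' := funext fun i => Subtype.ext (congrFun hfun i)
    subst this
    rfl
  refine h1.trans ?_
  rw [mul_comm r, pow_mul, ← Fin.prod_const r (2 ^ (d - r + 1)), ← Finset.prod_mul_distrib]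
  refine Finset.prod_le_prod' fun i _ => ?_
  have hi := i.2
  obtain ⟨e, he⟩ := Nat.exists_eq_add_of_le hr
  rw [he, Nat.add_sub_cancel_left, Nat.mul_sub, ← pow_add, ← pow_add]
  have h2 : 2 ^ (e + 1 + (i : ℕ)) ≤ 2 ^ (r + e) := Nat.pow_le_pow_right (by norm_num) (by omega)
  have h3 : 2 ^ (e + 1 + r) = 2 * 2 ^ (r + e) := by ring
  rw [h3]
  generalize 2 ^ (r + e) = x at h2 ⊢
  generalize 2 ^ (e + 1 + (i : ℕ)) = y at h2 ⊢
  generalize 2 ^ (i : ℕ) = z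
  omega

/-! ### Relations in the Witt ring and sums of squares. -/

namespace SymbolLength
variable {F R : Type*} [Field F] [CommRing R]

/-- A commutative ring `R` in which isometry classes of forms have values that are additive,
multiplicative on one-dimensional forms, trivial on the hyperbolic plane, and generate `R`. -/
structure WittSystem (F R : Type*) [Field F] [CommRing R] where
  unary : Fˣ →* R
  val : IsoClass F → R
  val_isoClass (a : List Fˣ) : val (isoClass a) = (a.map unary).sum
  unary_neg_one : unary (-1) = -1
  closure_range : AddSubgroup.closure (Set.range unary) = ⊤

namespace WittSystem
variable (S : WittSystem F R)

theorem sum_unary_eq_of_equivalent {a b : List Fˣ} (h : (diag a).Equivalent (diag b)) :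
    (a.map S.unary).sum = (b.map S.unary).sum := by
  rw [← S.val_isoClass, ← S.val_isoClass]
  exact congrArg S.val (Quotient.sound h)

theorem unary_neg (a : Fˣ) : S.unary (-a) = -S.unary a := by
  rw [← neg_one_mul, map_mul, S.unary_neg_one, neg_one_mul]

theorem unary_sq (c : Fˣ) : S.unary (c ^ 2) = 1 := by
  have h : (diag [c ^ 2]).Equivalent (diag [1]) := by
    refine ⟨⟨LinearEquiv.smulOfUnit c, fun v => ?_⟩⟩
    have h1 : (LinearEquiv.smulOfUnit (M := Fin 1 → F) c) v 0 = c * v 0 := rfl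
    have h2 : (diag [1]) (LinearEquiv.smulOfUnit (M := Fin 1 → F) c v) =
        (c * v 0 : F) * (c * v 0) := by
      simp [diag, QuadraticMap.weightedSumSquares_apply, ← h1]
    refine h2.trans ?_
    simp [diag, QuadraticMap.weightedSumSquares_apply]
    ring
  simpa using S.sum_unary_eq_of_equivalent h

theorem unary_add_unary (a b c : Fˣ) (h : (c : F) = a + b) :
    S.unary a + S.unary b = S.unary c + S.unary (a * b * c) := by
  have hc : (a : F) + b ≠ 0 := h ▸ c.ne_zero
  have h : (diag [c, a * b * c]).Equivalent (diag [a, b]) := by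
    -- The orthogonal basis `(1, 1)`, `(-b, a)` of `⟨a, b⟩` has the values `a + b = c` and `ab(a +
    -- b) = abc`.
    refine ⟨⟨LinearEquiv.ofLinearMap (Matrix.toLin' !![1, -(b : F); 1, (a : F)])
      (Matrix.toLin' !![a / (a + b : F), b / (a + b : F); -1 / (a + b : F), 1 / (a + b : F)])
      ?_ ?_, fun v => ?_⟩⟩
    · rw [← Matrix.toLin'_mul, ← Matrix.toLin'_one]
      congr 1
      ext i j
      fin_cases i <;> fin_cases j <;> simp [Matrix.mul_apply, Fin.sum_univ_two] <;> field_simp <;>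
        ring
    · rw [← Matrix.toLin'_mul, ← Matrix.toLin'_one]
      congr 1
      ext i j
      fin_cases i <;> fin_cases j <;> simp [Matrix.mul_apply, Fin.sum_univ_two] <;> field_simp <;>
        ring
    · have e1 : ∀ w : Fin 2 → F, diag [a, b] w = a * (w 0 * w 0) + b * (w 1 * w 1) := fun w => by
        simp [diag, QuadraticMap.weightedSumSquares_apply, Fin.sum_univ_two]
      have e2 : diag [c, a * b * c] v = c * (v 0 * v 0) + a * b * c * (v 1 * v 1) := by
        simp [diag, QuadraticMap.weightedSumSquares_apply, Fin.sum_univ_two]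
      rw [e2]
      refine (e1 _).trans ?_
      simp [Matrix.toLin'_apply, Matrix.mulVec, dotProduct, Fin.sum_univ_two]
      rw [h]
      ring
  simpa using (S.sum_unary_eq_of_equivalent h).symm

theorem exists_add_of_sum_two_pow_succ {m : ℕ} (y : Fin (2 ^ (m + 1)) → F) :
    ∃ u v : Fin (2 ^ m) → F, ∑ i, y i ^ 2 = ∑ i, u i ^ 2 + ∑ i, v i ^ 2 ∧
      (y ≠ 0 → u ≠ 0 ∨ v ≠ 0) := by
  have e : 2 ^ (m + 1) = 2 ^ m + 2 ^ m := by ring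
  refine ⟨fun i => y (Fin.cast e.symm (Fin.castAdd _ i)),
    fun i => y (Fin.cast e.symm (Fin.natAdd _ i)), ?_, fun h => ?_⟩
  · rw [← Fin.sum_univ_add fun i => y (Fin.cast e.symm i) ^ 2]
    exact (Equiv.sum_comp (finCongr e.symm) fun i => y i ^ 2).symm
  · by_contra! hc
    refine h (funext fun i => ?_)
    obtain ⟨j, rfl⟩ := (finCongr e.symm).surjective i
    induction j using Fin.addCases with
    | left j => exact congrFun hc.1 j
    | right j => exact congrFun hc.2 j

/-- This is Pfister's theorem that elements represented by `2^m ⟨1⟩` are similarity factors of it.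
Split `c = u + v` into sums of half the length and multiply `⟨u⟩ + ⟨v⟩ = ⟨c⟩ + ⟨uvc⟩` by `2^m`: by
induction `⟨u⟩` and `⟨v⟩` become `1`. If one half vanishes, `c` is already a shorter sum. -/
theorem two_pow_mul_unary {m : ℕ} (c : Fˣ) (y : Fin (2 ^ m) → F) (h : (c : F) = ∑ i, y i ^ 2) :
    2 ^ m * S.unary c = (2 ^ m : R) := by
  induction m generalizing c with
  | zero =>
    have hy : (c : F) = y 0 ^ 2 := h.trans (Fintype.sum_unique (ι := Fin 1) fun i => y i ^ 2)
    have h0 : y 0 ≠ 0 := fun h0 => c.ne_zero (by rw [hy, h0]; ring)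
    have hc : c = Units.mk0 _ h0 ^ 2 := Units.ext hy
    rw [hc, S.unary_sq, mul_one]
  | succ m ih =>
    obtain ⟨u, v, huv, -⟩ := exists_add_of_sum_two_pow_succ y
    rw [huv] at h
    by_cases hu : ∑ i, u i ^ 2 = 0
    · rw [hu, zero_add] at h
      rw [pow_succ', mul_assoc, ih c v h]
    by_cases hv : ∑ i, v i ^ 2 = 0
    · rw [hv, add_zero] at h
      rw [pow_succ', mul_assoc, ih c u h]
    have h1 := ih (Units.mk0 _ hu) u rfl
    have h2 := ih (Units.mk0 _ hv) v rfl
    have h3 := S.unary_add_unary (Units.mk0 _ hu) (Units.mk0 _ hv) c h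
    rw [map_mul, map_mul] at h3
    generalize S.unary (Units.mk0 _ hu) = x at h1 h3
    generalize S.unary (Units.mk0 _ hv) = z at h1 h2 h3
    linear_combination (-2 ^ m) * h3 + h1 + h2 - S.unary c * z * h1 - S.unary c * h2

/-- Split the sum into halves. If the first half is `u ≠ 0`, then `u` and `-u` are both sums of half
the length, so `2^m = 2^m ⟨u⟩ = -2^m` one level below. If both halves vanish, one of them is a
nontrivial zero. -/
theorem two_pow_eq_zero (S : WittSystem F R) {m : ℕ} (y : Fin (2 ^ m) → F) (hy : y ≠ 0)
    (h : ∑ i, y i ^ 2 = 0) :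
    (2 ^ m : R) = 0 := by
  induction m with
  | zero =>
    exfalso
    refine hy (funext fun i => ?_)
    have : Subsingleton (Fin (2 ^ 0)) := inferInstanceAs (Subsingleton (Fin 1))
    rw [Fintype.sum_subsingleton _ i] at h
    simpa using h
  | succ m ih =>
    obtain ⟨u, v, huv, h0⟩ := exists_add_of_sum_two_pow_succ y
    rw [h] at huv
    by_cases hu : ∑ i, u i ^ 2 = 0
    · rw [hu, zero_add] at huv
      rw [pow_succ]
      rcases h0 hy with h1 | h1
      · rw [ih u h1 hu, zero_mul]
      · rw [ih v h1 huv.symm, zero_mul]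
    · have h1 := S.two_pow_mul_unary (Units.mk0 _ hu) u rfl
      have h2 := S.two_pow_mul_unary (-Units.mk0 _ hu) v (by
        rw [Units.val_neg, Units.val_mk0]; linear_combination huv)
      rw [S.unary_neg] at h2
      linear_combination -h1 - h2

/-- For a sum of `2^m` squares the product is `0`, for `-1` it is `2^(m+1)`; `1 - xy = (1 - x) + x(1
- y)` extends this to the generated group. It is the reason why level `m` sees slots only modulo
`±D_F(2^m)`. -/
theorem two_pow_mul_one_sub_unary {m : ℕ} {c : Fˣ} (hc : c ∈ plusMinusD F m) :
    2 ^ m * (1 - S.unary c) ∈ Ideal.span {(2 ^ (m + 1) : R)} := by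
  induction hc using Subgroup.closure_induction with
  | mem x hx =>
    rcases hx with ⟨y, hy⟩ | rfl
    · rw [mul_sub, mul_one, S.two_pow_mul_unary x y hy, sub_self]
      exact zero_mem _
    · rw [S.unary_neg_one]
      convert Ideal.mem_span_singleton_self _ using 1
      ring
  | one => simp
  | mul x y _ _ hx hy =>
    convert add_mem hx (Ideal.mul_mem_left _ (S.unary x) hy) using 1
    rw [map_mul]
    ring
  | inv x _ hx =>
    convert Ideal.mul_mem_left _ (-S.unary x⁻¹) hx using 1
    have : S.unary x⁻¹ * S.unary x = 1 := by rw [← map_mul, inv_mul_cancel, map_one]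
    linear_combination (-2 ^ m) * this

theorem two_pow_eq_zero_of_isSumSq_neg_one (S : WittSystem F R) {s : ℕ}
    (h : pythagorasNumber F < (2 : ℕ∞) ^ (s + 1))
    (hF : IsSumSq (-1 : F)) : (2 ^ (s + 1) : R) = 0 := by
  obtain ⟨p, ⟨k, rfl, hk⟩, hlt⟩ := sInf_lt_iff.1 h
  have hlt : k < 2 ^ (s + 1) := by exact_mod_cast hlt
  obtain ⟨y, hy⟩ := hk _ hF
  obtain ⟨e, he⟩ := Nat.exists_eq_add_of_lt hlt
  -- The `k` squares with sum `-1`, then one square `1`, then zeros up to length `2^(s+1)`: a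
  -- nontrivial zero.
  let z : Fin (k + (e + 1)) → F := Fin.append y (Pi.single 0 1)
  refine S.two_pow_eq_zero (fun i => z (Fin.cast he i)) (fun h0 => ?_) ?_
  · have := congrFun h0 (Fin.cast he.symm (Fin.natAdd k (0 : Fin (e + 1))))
    simp [z] at this
  · refine (Equiv.sum_comp (finCongr he) fun i => z i ^ 2).trans ?_
    refine (Fin.sum_univ_add (a := k) (b := e + 1) fun i => z i ^ 2).trans ?_
    simp [z, ← hy, Fin.sum_univ_succ]
end WittSystem
end SymbolLength

/-! ### The fundamental ideal, Pfister forms and the filtration by slots equal to `1`. -/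

namespace SymbolLength
variable {F R : Type*} [Field F] [CommRing R]

theorem HasOnes.mono {n m m' : ℕ} (hm : m ≤ m') {c : IsoClass F} (h : HasOnes n m' c) :
    HasOnes n m c := by
  obtain ⟨l, hl, rfl⟩ := h
  refine ⟨List.replicate (m' - m) 1 ++ l, ?_, ?_⟩
  · simp only [List.length_append, List.length_replicate]
    omega
  · rw [← List.append_assoc, List.replicate_append_replicate, Nat.add_sub_cancel' hm]

theorem HasOnes.mem_pfisterClasses {n m : ℕ} {c : IsoClass F} (h : HasOnes n m c) :
    c ∈ pfisterClasses F n := by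
  obtain ⟨l, hl, rfl⟩ := h
  exact ⟨_, by simp [hl], rfl⟩

namespace WittSystem
variable (S : WittSystem F R)

/-- The ideal of `R` corresponding to the fundamental ideal. -/
def ideal : Ideal R := Ideal.span (Set.range fun a => 1 - S.unary a)

theorem one_sub_unary_mem (a : Fˣ) : 1 - S.unary a ∈ S.ideal := Ideal.subset_span ⟨a, rfl⟩

theorem one_add_unary_eq (a : Fˣ) : 1 + S.unary a = 1 - S.unary (-a) := by
  rw [S.unary_neg, sub_neg_eq_add]

theorem one_add_unary_mem (a : Fˣ) : 1 + S.unary a ∈ S.ideal := by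
  rw [S.one_add_unary_eq]
  exact S.one_sub_unary_mem _

theorem two_mem : (2 : R) ∈ S.ideal := by
  have := S.one_add_unary_mem 1
  rwa [map_one, one_add_one_eq_two] at this

/-- This is the parity of the dimension: modulo the ideal, each generator `⟨a⟩` is `1` and `2` is
`0`. -/
theorem mem_or_sub_one_mem (x : R) : x ∈ S.ideal ∨ x - 1 ∈ S.ideal := by
  have hx : x ∈ AddSubgroup.closure (Set.range S.unary) := S.closure_range ▸ AddSubgroup.mem_top x
  induction hx using AddSubgroup.closure_induction with
  | mem x hx =>
    obtain ⟨a, rfl⟩ := hx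
    exact Or.inr ((Ideal.neg_mem_iff _).1 (by simpa using S.one_sub_unary_mem a))
  | zero => exact Or.inl (zero_mem _)
  | add x y _ _ hx hy =>
    rcases hx with hx | hx <;> rcases hy with hy | hy
    · exact Or.inl (add_mem hx hy)
    · exact Or.inr (by convert add_mem hx hy using 1; ring)
    · exact Or.inr (by convert add_mem hx hy using 1; ring)
    · exact Or.inl (by convert add_mem (add_mem hx hy) S.two_mem using 1; ring)
  | neg x _ hx =>
    rcases hx with hx | hx
    · exact Or.inl (neg_mem hx)
    · exact Or.inr (by convert neg_mem (add_mem hx S.two_mem) using 1; ring)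

theorem sum_map_unary_tensor (a b : List Fˣ) :
    ((tensor a b).map S.unary).sum = (a.map S.unary).sum * (b.map S.unary).sum := by
  induction a with
  | nil => simp [tensor]
  | cons x a ih =>
    simp only [tensor, List.flatMap_cons, List.map_append, List.sum_append, List.map_cons,
      List.sum_cons, add_mul] at ih ⊢
    rw [ih, List.map_map, ← List.sum_map_mul_left]
    simp [Function.comp_def, List.sum_map_mul_left]

theorem val_pfister (l : List Fˣ) :
    S.val (isoClass (pfister l)) = (l.map fun a => 1 + S.unary a).prod := by
  rw [S.val_isoClass]
  induction l with
  | nil => simp [pfister]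
  | cons a l ih => simp [pfister, sum_map_unary_tensor, ih]

theorem val_pfister_replicate_append (m : ℕ) (l : List Fˣ) :
    S.val (isoClass (pfister (List.replicate m 1 ++ l))) =
      2 ^ m * (l.map fun a => 1 + S.unary a).prod := by
  simp [val_pfister, one_add_one_eq_two]

theorem prod_one_add_unary_mem (l : List Fˣ) :
    (l.map fun a => 1 + S.unary a).prod ∈ S.ideal ^ l.length := by
  induction l with
  | nil => simp
  | cons a l ih =>
    rw [List.map_cons, List.prod_cons, List.length_cons, pow_succ']
    exact Ideal.mul_mem_mul (S.one_add_unary_mem a) ih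

theorem ideal_pow_le_span (r : ℕ) :
    S.ideal ^ r ≤ Ideal.span
      {x | ∃ l : List Fˣ, l.length = r ∧ x = (l.map fun a => 1 + S.unary a).prod} := by
  induction r with
  | zero =>
    have h : (1 : R) ∈ Ideal.span
        {x | ∃ l : List Fˣ, l.length = 0 ∧ x = (l.map fun a => 1 + S.unary a).prod} :=
      Ideal.subset_span ⟨[], rfl, rfl⟩
    exact ((Ideal.eq_top_iff_one _).2 h).ge.trans' le_top
  | succ r ih =>
    rw [pow_succ']
    refine (Ideal.mul_mono_right ih).trans ?_
    rw [ideal, Ideal.span_mul_span', Ideal.span_le]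
    rintro _ ⟨_, ⟨a, rfl⟩, _, ⟨l, rfl, rfl⟩, rfl⟩
    exact Ideal.subset_span ⟨-a :: l, rfl, by simp [S.one_add_unary_eq]⟩

/-- The ideal `2^m I^(n-m) + I^(n+1)`. -/
def onesIdeal (n m : ℕ) : Ideal R := Ideal.span {2 ^ m} * S.ideal ^ (n - m) ⊔ S.ideal ^ (n + 1)

theorem pow_succ_le_onesIdeal (n m : ℕ) : S.ideal ^ (n + 1) ≤ S.onesIdeal n m := le_sup_right

theorem two_pow_mul_mem_onesIdeal {n m : ℕ} {x : R} (hx : x ∈ S.ideal ^ (n - m)) :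
    2 ^ m * x ∈ S.onesIdeal n m :=
  Ideal.mem_sup_left (Ideal.mul_mem_mul (Ideal.mem_span_singleton_self _) hx)

theorem onesIdeal_zero (n : ℕ) : S.onesIdeal n 0 = S.ideal ^ n := by
  simp [onesIdeal, Ideal.pow_le_pow_right (Nat.le_succ n)]

theorem onesIdeal_succ_self (n : ℕ) : S.onesIdeal n (n + 1) = S.ideal ^ (n + 1) := by
  refine sup_eq_right.2 ?_
  -- The exponent `n - (n + 1)` truncates to `0`, so the first summand is generated by `2^(n+1)`,
  -- which lies in the `(n + 1)`-st power.
  rw [Nat.sub_eq_zero_of_le (Nat.le_succ n), pow_zero, mul_one, Ideal.span_le,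
    Set.singleton_subset_iff]
  exact Ideal.pow_mem_pow S.two_mem _

variable {S}

theorem val_mem_onesIdeal {n m : ℕ} {c : IsoClass F} (h : HasOnes n m c) :
    S.val c ∈ S.onesIdeal n m := by
  obtain ⟨l, hl, rfl⟩ := h
  rw [S.val_pfister_replicate_append]
  refine S.two_pow_mul_mem_onesIdeal ?_
  rw [← hl, Nat.add_sub_cancel_left]
  exact S.prod_one_add_unary_mem l

theorem val_mem_pow {n m : ℕ} {c : IsoClass F} (h : HasOnes n m c) : S.val c ∈ S.ideal ^ n := by
  rw [← onesIdeal_zero]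
  exact val_mem_onesIdeal (h.mono (Nat.zero_le m))

theorem two_mul_val_mem {n m : ℕ} {c : IsoClass F} (h : HasOnes n m c) :
    2 * S.val c ∈ S.ideal ^ (n + 1) := by
  rw [pow_succ']
  exact Ideal.mul_mem_mul S.two_mem (val_mem_pow h)

open scoped Classical in
-- The symmetric difference works: a class occurring in both sets contributes twice its value, which
-- lies in the `(n + 1)`-st power.
theorem exists_finset_add {n m : ℕ} {P Q : Finset (IsoClass F)} (hP : ∀ c ∈ P, HasOnes n m c)
    (hQ : ∀ c ∈ Q, HasOnes n m c) : ∃ T : Finset (IsoClass F), (∀ c ∈ T, HasOnes n m c) ∧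
      T.card ≤ P.card + Q.card ∧
      ∑ c ∈ P, S.val c + ∑ c ∈ Q, S.val c - ∑ c ∈ T, S.val c ∈ S.ideal ^ (n + 1) := by
  refine ⟨(P \ Q) ∪ (Q \ P), fun c hc => ?_, ?_, ?_⟩
  · rcases Finset.mem_union.1 hc with h | h
    · exact hP c (Finset.mem_sdiff.1 h).1
    · exact hQ c (Finset.mem_sdiff.1 h).1
  · exact (Finset.card_union_le _ _).trans
      (add_le_add (Finset.card_le_card Finset.sdiff_subset)
        (Finset.card_le_card Finset.sdiff_subset))
  · rw [Finset.sum_union (Finset.disjoint_left.2 fun c h1 h2 =>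
      (Finset.mem_sdiff.1 h1).2 (Finset.mem_sdiff.1 h2).1)]
    have h1 := Finset.sum_inter_add_sum_sdiff P Q S.val
    have h2 := Finset.sum_inter_add_sum_sdiff Q P S.val
    rw [Finset.inter_comm] at h2
    have h3 : ∑ c ∈ P ∩ Q, 2 * S.val c ∈ S.ideal ^ (n + 1) :=
      Ideal.sum_mem _ fun c hc => two_mul_val_mem (hP c (Finset.mem_inter.1 hc).1)
    rw [← Finset.mul_sum] at h3
    convert h3 using 1
    linear_combination -h1 - h2

/-- The elements with such a representation form an ideal `J`. Scalars act on the `n`-th power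
modulo the `(n + 1)`-st as `0` or `1`, by `mem_or_sub_one_mem`, so no coefficients are needed. -/
theorem exists_finset_of_mem_onesIdeal {n m : ℕ} (hm : m ≤ n) {x : R} (hx : x ∈ S.onesIdeal n m) :
    ∃ P : Finset (IsoClass F), (∀ c ∈ P, HasOnes n m c) ∧
      x - ∑ c ∈ P, S.val c ∈ S.ideal ^ (n + 1) := by
  let J : Ideal R :=
    { carrier := {x | ∃ P : Finset (IsoClass F), (∀ c ∈ P, HasOnes n m c) ∧
        x - ∑ c ∈ P, S.val c ∈ S.ideal ^ (n + 1)}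
      zero_mem' := ⟨∅, by simp, by simp⟩
      add_mem' := by
        rintro x y ⟨P, hP, hx⟩ ⟨Q, hQ, hy⟩
        obtain ⟨T, hT, -, h⟩ := exists_finset_add (S := S) hP hQ
        refine ⟨T, hT, ?_⟩
        convert add_mem (add_mem hx hy) h using 1
        ring
      smul_mem' := by
        rintro c x ⟨P, hP, hx⟩
        have hxn : x ∈ S.ideal ^ n := by
          have h1 := Ideal.sum_mem (S.ideal ^ n) fun c hc => val_mem_pow (S := S) (hP c hc)
          convert add_mem (Ideal.pow_le_pow_right (Nat.le_succ n) hx) h1 using 1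
          ring
        rcases S.mem_or_sub_one_mem c with hc | hc
        · refine ⟨∅, by simp, ?_⟩
          rw [Finset.sum_empty, sub_zero, smul_eq_mul, pow_succ']
          exact Ideal.mul_mem_mul hc hxn
        · refine ⟨P, hP, ?_⟩
          have h1 := Ideal.mul_mem_mul hc hxn
          rw [← pow_succ'] at h1
          convert add_mem h1 hx using 1
          rw [smul_eq_mul]
          ring }
  have hJ : S.onesIdeal n m ≤ J := by
    refine sup_le ?_ fun x hx => ⟨∅, by simp, by simpa using hx⟩
    refine (Ideal.mul_mono_right (S.ideal_pow_le_span _)).trans ?_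
    rw [Ideal.span_mul_span', Ideal.span_le]
    rintro _ ⟨_, rfl, _, ⟨l, hl, rfl⟩, rfl⟩
    refine ⟨{isoClass (pfister (List.replicate m 1 ++ l))}, ?_, ?_⟩
    · simp only [Finset.mem_singleton, forall_eq]
      exact ⟨l, by omega, rfl⟩
    · simp [S.val_pfister_replicate_append]
  exact hJ hx

end WittSystem
end SymbolLength

/-! ### Symbols as alternating maps on `Fˣ/±D_F(2^m)`. -/

/-- Over `𝔽₂`, scalar multiplication is no condition on alternating maps. -/
def AlternatingMap.ofZModTwo {V A ι : Type*} [AddCommGroup V] [Module (ZMod 2) V] [AddCommGroup A]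
    [Module (ZMod 2) A] (f : (ι → V) → A)
    (hadd : ∀ [DecidableEq ι] (v : ι → V) (i : ι) (x y : V), f (Function.update v i (x + y)) =
      f (Function.update v i x) + f (Function.update v i y))
    (halt : ∀ (v : ι → V) (i j : ι), v i = v j → i ≠ j → f v = 0) : V [⋀^ι]→ₗ[ZMod 2] A where
  toFun := f
  map_update_add' := hadd
  map_update_smul' := by
    intro _ v i c x
    have h0 : f (Function.update v i 0) = 0 := by simpa using hadd v i 0 0
    have : ∀ c : ZMod 2, c = 0 ∨ c = 1 := by decide
    rcases this c with rfl | rfl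
    · rw [zero_smul, zero_smul, h0]
    · rw [one_smul, one_smul]
  map_eq_zero_of_eq' := halt

namespace SymbolLength
variable {F R : Type*} [Field F] [CommRing R]

/-- The square class of a unit. -/
def squareClass (a : Fˣ) : SquareClassSpace F := Additive.ofMul (QuotientGroup.mk a)

/-- The class of a unit in `Fˣ/±D_F(2^m)`. -/
def plusMinusClass (m : ℕ) (a : Fˣ) : PlusMinusSpace F m := Additive.ofMul (QuotientGroup.mk a)

theorem squares_le_plusMinusD (m : ℕ) : squares F ≤ plusMinusD F m := by
  rintro _ ⟨u, rfl⟩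
  have h := two_nsmul_plusMinus F m (plusMinusClass m u)
  exact (QuotientGroup.eq_one_iff _).1 (congrArg Additive.toMul h)

/-- The projection `Fˣ/Fˣ² → Fˣ/±D_F(2^m)`. -/
noncomputable def projPlusMinus (m : ℕ) : SquareClassSpace F →ₗ[ZMod 2] PlusMinusSpace F m :=
  (MonoidHom.toAdditive (QuotientGroup.map (squares F) (plusMinusD F m) (MonoidHom.id Fˣ)
    (squares_le_plusMinusD m))).toZModLinearMap 2

theorem projPlusMinus_surjective (m : ℕ) : Function.Surjective (projPlusMinus (F := F) m) := by
  intro x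
  obtain ⟨a, ha⟩ := QuotientGroup.mk_surjective (Additive.toMul x)
  exact ⟨squareClass a, congrArg Additive.ofMul ha⟩

theorem dimPM_le [Finite (SquareClassSpace F)] (m : ℕ) :
    dimPM F m ≤ finrank (ZMod 2) (SquareClassSpace F) :=
  have : Module.Finite (ZMod 2) (SquareClassSpace F) := Module.Finite.of_finite
  LinearMap.finrank_le_finrank_of_surjective (projPlusMinus_surjective m)

theorem plusMinusClass_out {m : ℕ} (x : PlusMinusSpace F m) :
    plusMinusClass m (Additive.toMul x).out = x :=
  congrArg Additive.ofMul (QuotientGroup.out_eq' (Additive.toMul x))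

theorem plusMinusClass_mul (m : ℕ) (a b : Fˣ) :
    plusMinusClass m (a * b) = plusMinusClass m a + plusMinusClass m b := rfl

/-- The class of the Pfister form with `m` slots `1` and the slots `-aᵢ`. -/
def onesPfister (m : ℕ) {k : ℕ} (a : Fin k → Fˣ) : IsoClass F :=
  isoClass (pfister (List.replicate m 1 ++ List.ofFn fun i => -a i))

theorem hasOnes_onesPfister {n m : ℕ} (hm : m ≤ n) (a : Fin (n - m) → Fˣ) :
    HasOnes n m (onesPfister m a) :=
  ⟨List.ofFn fun i => -a i, by rw [List.length_ofFn]; omega, rfl⟩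

theorem HasOnes.exists_eq_onesPfister {n m : ℕ} {c : IsoClass F} (h : HasOnes n m c) :
    ∃ a : Fin (n - m) → Fˣ, c = onesPfister m a := by
  obtain ⟨l, hl, rfl⟩ := h
  have hl : n - m = l.length := by omega
  rw [hl]
  refine ⟨fun i => -l.get i, ?_⟩
  simp [onesPfister]

namespace WittSystem
variable (S : WittSystem F R)

theorem val_onesPfister (m : ℕ) {k : ℕ} (a : Fin k → Fˣ) :
    S.val (onesPfister m a) = 2 ^ m * ∏ i, (1 - S.unary (a i)) := by
  rw [onesPfister, val_pfister_replicate_append, List.map_ofFn, List.prod_ofFn]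
  simp [S.one_add_unary_eq]

theorem prod_one_sub_unary_mem {ι : Type*} (s : Finset ι) (a : ι → Fˣ) :
    ∏ i ∈ s, (1 - S.unary (a i)) ∈ S.ideal ^ s.card := by
  rw [← Finset.prod_const]
  exact Ideal.prod_mem_prod fun i _ => S.one_sub_unary_mem _

theorem two_pow_mul_unary_sub_unary_mem {m : ℕ} {a b : Fˣ}
    (h : plusMinusClass m a = plusMinusClass m b) :
    2 ^ m * ((1 - S.unary a) - (1 - S.unary b)) ∈ Ideal.span {(2 ^ (m + 1) : R)} := by
  have h1 : a⁻¹ * b ∈ plusMinusD F m := QuotientGroup.eq.1 (congrArg Additive.toMul h)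
  have h2 := Ideal.mul_mem_left _ (-S.unary a) (S.two_pow_mul_one_sub_unary h1)
  convert h2 using 1
  have h3 : S.unary a * S.unary (a⁻¹ * b) = S.unary b := by rw [← map_mul, mul_inv_cancel_left]
  linear_combination -2 ^ m * h3

/-- Replace one factor at a time: each replacement trades `2^m` and one factor of the product for a
multiple of `2^(m+1)`. -/
theorem two_pow_mul_prod_sub_prod_mem {ι : Type*} {m : ℕ} (s : Finset ι) (a b : ι → Fˣ)
    (h : ∀ i, plusMinusClass m (a i) = plusMinusClass m (b i)) :
    2 ^ m * (∏ i ∈ s, (1 - S.unary (a i)) - ∏ i ∈ s, (1 - S.unary (b i))) ∈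
      Ideal.span {(2 ^ (m + 1) : R)} * S.ideal ^ (s.card - 1) := by
  classical
  induction s using Finset.induction with
  | empty => simp
  | insert j s hj ih =>
    rw [Finset.prod_insert hj, Finset.prod_insert hj, Finset.card_insert_of_notMem hj,
      Nat.add_sub_cancel]
    have h1 := Ideal.mul_mem_mul (S.two_pow_mul_unary_sub_unary_mem (h j))
      (S.prod_one_sub_unary_mem s a)
    have h2 : (1 - S.unary (b j)) * (2 ^ m * (∏ i ∈ s, (1 - S.unary (a i)) -
        ∏ i ∈ s, (1 - S.unary (b i)))) ∈
        Ideal.span {(2 ^ (m + 1) : R)} * S.ideal ^ s.card := by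
      rcases s.eq_empty_or_nonempty with rfl | hs
      · simp
      · have h3 := Ideal.mul_mem_mul (S.one_sub_unary_mem (b j)) ih
        rwa [mul_left_comm S.ideal, ← pow_succ',
          Nat.sub_add_cancel (Finset.card_pos.2 hs)] at h3
    convert add_mem h1 h2 using 1
    ring

/-- The `2`-torsion of the quotient of `R` by `onesIdeal`. -/
abbrev SymbolSpace (n m : ℕ) : Type _ :=
  AddSubgroup.torsionBy (R ⧸ S.onesIdeal n (m + 1)) ((2 : ℕ) : ℤ)

/-- The whole quotient need not be killed by `2`, but symbols are, since twice an element of the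
`n`-th power lies in the `(n + 1)`-st. Restricting to the `2`-torsion makes `𝔽₂`-linear algebra
available. -/
noncomputable instance (n m : ℕ) : Module (ZMod 2) (S.SymbolSpace n m) :=
  AddSubgroup.torsionBy.zmodModule

theorem two_pow_mul_mem_pow {n m : ℕ} (hm : m ≤ n) {x : R} (hx : x ∈ S.ideal ^ (n - m)) :
    2 ^ m * x ∈ S.ideal ^ n := by
  have h := Ideal.mul_mem_mul (Ideal.pow_mem_pow S.two_mem m) hx
  rwa [← pow_add, Nat.add_sub_cancel' hm] at h

/-- The class of `2^m ⟨⟨-a₁, …, -aₖ⟩⟩`. -/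
noncomputable def symbol {n m : ℕ} (hm : m ≤ n) (a : Fin (n - m) → Fˣ) : S.SymbolSpace n m :=
  ⟨Ideal.Quotient.mk _ (2 ^ m * ∏ i, (1 - S.unary (a i))), by
    have h := S.prod_one_sub_unary_mem Finset.univ a
    rw [Finset.card_univ, Fintype.card_fin] at h
    have h1 := Ideal.mul_mem_mul S.two_mem (S.two_pow_mul_mem_pow hm h)
    rw [← pow_succ'] at h1
    have h2 := Ideal.Quotient.eq_zero_iff_mem.2 (S.pow_succ_le_onesIdeal n (m + 1) h1)
    rw [map_mul, map_ofNat] at h2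
    refine (natCast_zsmul (Ideal.Quotient.mk (S.onesIdeal n (m + 1)) _) 2).trans ?_
    rw [two_nsmul, ← two_mul, h2]⟩

theorem symbol_eq_iff {n m : ℕ} (hm : m ≤ n) (a b : Fin (n - m) → Fˣ) :
    S.symbol hm a = S.symbol hm b ↔
      2 ^ m * (∏ i, (1 - S.unary (a i)) - ∏ i, (1 - S.unary (b i))) ∈ S.onesIdeal n (m + 1) := by
  rw [mul_sub]
  exact Subtype.ext_iff.trans Ideal.Quotient.eq

theorem symbol_congr {n m : ℕ} (hm : m ≤ n) (a b : Fin (n - m) → Fˣ)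
    (h : ∀ i, plusMinusClass m (a i) = plusMinusClass m (b i)) :
    S.symbol hm a = S.symbol hm b := by
  rw [symbol_eq_iff]
  have := S.two_pow_mul_prod_sub_prod_mem Finset.univ a b h
  rw [Finset.card_univ, Fintype.card_fin, Nat.sub_sub] at this
  exact Ideal.mem_sup_left this

/-- By `1 - xy = (1 - x) + (1 - y) - (1 - x)(1 - y)`, the deviation from additivity has one factor
more and so lies in the `(n + 1)`-st power. -/
theorem symbol_update {n m : ℕ} (hm : m ≤ n) [DecidableEq (Fin (n - m))] (a : Fin (n - m) → Fˣ)
    (i : Fin (n - m)) (x y : Fˣ) : S.symbol hm (Function.update a i (x * y)) =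
      S.symbol hm (Function.update a i x) + S.symbol hm (Function.update a i y) := by
  have hprod : ∀ z, ∏ j, (1 - S.unary (Function.update a i z j)) =
      (1 - S.unary z) * ∏ j ∈ Finset.univ.erase i, (1 - S.unary (a j)) := by
    intro z
    rw [← Finset.mul_prod_erase _ _ (Finset.mem_univ i), Function.update_self]
    congr 1
    refine Finset.prod_congr rfl fun j hj => ?_
    rw [Function.update_of_ne (Finset.ne_of_mem_erase hj)]
  refine Subtype.ext ?_
  change Ideal.Quotient.mk _ _ = Ideal.Quotient.mk _ _ + Ideal.Quotient.mk _ _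
  rw [← map_add, Ideal.Quotient.eq, hprod, hprod, hprod, map_mul]
  have h1 := S.prod_one_sub_unary_mem (Finset.univ.erase i) a
  rw [Finset.card_erase_of_mem (Finset.mem_univ i), Finset.card_univ, Fintype.card_fin] at h1
  have h2 := Ideal.mul_mem_mul (Ideal.mul_mem_mul (Ideal.mul_mem_mul
    (Ideal.pow_mem_pow S.two_mem m) (S.one_sub_unary_mem x)) (S.one_sub_unary_mem y)) h1
  have hi := i.2
  rw [← pow_succ, ← pow_succ, ← pow_add, show m + 1 + 1 + (n - m - 1) = n + 1 by omega] at h2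
  refine S.pow_succ_le_onesIdeal _ _ ?_
  convert neg_mem h2 using 1
  ring

/-- Since `⟨a⟩² = 1`, one has `(1 - ⟨a⟩)² = 2(1 - ⟨a⟩)`: a repeated slot can be traded for a slot
`1`, which moves the form to level `m + 1`. -/
theorem symbol_eq_zero {n m : ℕ} (hm : m ≤ n) (a : Fin (n - m) → Fˣ) (i j : Fin (n - m))
    (hij : i ≠ j) (h : a i = a j) : S.symbol hm a = 0 := by
  refine Subtype.ext (Ideal.Quotient.eq_zero_iff_mem.2 ?_)
  have hj : j ∈ Finset.univ.erase i := Finset.mem_erase.2 ⟨hij.symm, Finset.mem_univ j⟩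
  rw [← Finset.mul_prod_erase _ _ (Finset.mem_univ i), ← Finset.mul_prod_erase _ _ hj, h]
  have hsq := S.unary_sq (a j)
  rw [map_pow] at hsq
  have h1 := S.prod_one_sub_unary_mem (Finset.univ.erase i) a
  rw [Finset.card_erase_of_mem (Finset.mem_univ i), Finset.card_univ, Fintype.card_fin,
    ← Finset.mul_prod_erase _ _ hj, Nat.sub_sub] at h1
  convert S.two_pow_mul_mem_onesIdeal h1 using 1
  linear_combination (2 ^ m * ∏ i ∈ (Finset.univ.erase i).erase j, (1 - S.unary (a i))) * hsq

/-- The symbol as an alternating map. -/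
noncomputable def symbolMap {n m : ℕ} (hm : m ≤ n) :
    PlusMinusSpace F m [⋀^Fin (n - m)]→ₗ[ZMod 2] S.SymbolSpace n m :=
  AlternatingMap.ofZModTwo (fun v => S.symbol hm fun i => (Additive.toMul (v i)).out)
    (by
      intro _ v i x y
      -- Any representative `w` of the updated slot may be used, so for `x + y` the product of the
      -- chosen representatives can be taken.
      have h : ∀ z (w : Fˣ), plusMinusClass m w = z →
          (S.symbol hm fun j => (Additive.toMul (Function.update v i z j)).out) =
          S.symbol hm (Function.update (fun j => (Additive.toMul (v j)).out) i w) := by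
        intro z w hw
        refine S.symbol_congr hm _ _ fun j => ?_
        rw [plusMinusClass_out]
        by_cases hj : j = i
        · subst hj
          simp [hw]
        · simp [hj, plusMinusClass_out]
      rw [h x _ (plusMinusClass_out x), h y _ (plusMinusClass_out y), ← symbol_update]
      refine h _ _ ?_
      rw [plusMinusClass_mul, plusMinusClass_out, plusMinusClass_out])
    (fun v i j hv hij => S.symbol_eq_zero hm _ i j hij (by rw [hv]))

theorem symbolMap_plusMinusClass {n m : ℕ} (hm : m ≤ n) (a : Fin (n - m) → Fˣ) :
    S.symbolMap hm (fun i => plusMinusClass m (a i)) = S.symbol hm a :=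
  S.symbol_congr hm _ _ fun _ => plusMinusClass_out _

theorem coe_symbol {n m : ℕ} (hm : m ≤ n) (a : Fin (n - m) → Fˣ) :
    (S.symbol hm a : R ⧸ S.onesIdeal n (m + 1)) =
      Ideal.Quotient.mk _ (S.val (onesPfister m a)) := by
  rw [val_onesPfister]
  rfl

theorem val_onesPfister_mem_onesIdeal {n m : ℕ} (hm : m ≤ n) (a : Fin (n - m) → Fˣ)
    (h : ¬LinearIndependent (ZMod 2) fun i => plusMinusClass m (a i)) :
    S.val (onesPfister m a) ∈ S.onesIdeal n (m + 1) := by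
  rw [← Ideal.Quotient.eq_zero_iff_mem, ← S.coe_symbol hm, ← S.symbolMap_plusMinusClass,
    (S.symbolMap hm).map_linearDependent _ h]
  rfl

theorem exists_val_add_val_sub_val_mem
    {n m : ℕ} [FiniteDimensional (ZMod 2) (PlusMinusSpace F m)] (hm : m ≤ n)
    (a b : Fin (n - m) → Fˣ)
    (h : finrank (ZMod 2) ↥(Submodule.span (ZMod 2) (Set.range fun i => plusMinusClass m (a i)) ⊔
      Submodule.span (ZMod 2) (Set.range fun i => plusMinusClass m (b i))) ≤ n - m + 1) :
    S.val (onesPfister m a) + S.val (onesPfister m b) ∈ S.onesIdeal n (m + 1) ∨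
      ∃ c : Fin (n - m) → Fˣ, S.val (onesPfister m a) + S.val (onesPfister m b) -
        S.val (onesPfister m c) ∈ S.onesIdeal n (m + 1) := by
  have h1 := (S.symbolMap hm).add_eq_zero_or_exists_add_eq _ _ h
  rw [symbolMap_plusMinusClass, symbolMap_plusMinusClass] at h1
  rcases h1 with h1 | ⟨v, hv⟩
  · left
    have h2 := congrArg Subtype.val h1
    change (S.symbol hm a : R ⧸ S.onesIdeal n (m + 1)) + S.symbol hm b = 0 at h2
    rwa [coe_symbol, coe_symbol, ← map_add, Ideal.Quotient.eq_zero_iff_mem] at h2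
  · right
    refine ⟨fun i => (Additive.toMul (v i)).out, ?_⟩
    have h2 := congrArg Subtype.val hv
    change (S.symbol hm a : R ⧸ S.onesIdeal n (m + 1)) + S.symbol hm b =
      (S.symbol hm fun i => (Additive.toMul (v i)).out : R ⧸ S.onesIdeal n (m + 1)) at h2
    rwa [coe_symbol, coe_symbol, coe_symbol, ← map_add, Ideal.Quotient.eq] at h2

end WittSystem
end SymbolLength

/-! ### Shortest representations at each level, and their assembly. -/

namespace SymbolLength
variable {F R : Type*} [Field F] [CommRing R]
namespace WittSystem
variable (S : WittSystem F R)

open scoped Classical in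
-- Choose `A` of least cardinality. A class lying in level `m + 1` could be dropped, and two classes
-- with spans too close together could be replaced by at most one.
theorem exists_minimal_finset [Finite (SquareClassSpace F)] {n m : ℕ} (hm : m ≤ n) {x : R}
    (hx : x ∈ S.onesIdeal n m) : ∃ A : Finset (IsoClass F), (∀ c ∈ A, HasOnes n m c) ∧
      x - ∑ c ∈ A, S.val c ∈ S.onesIdeal n (m + 1) ∧
      (∀ c ∈ A, S.val c ∉ S.onesIdeal n (m + 1)) ∧
      ∀ a b : Fin (n - m) → Fˣ, onesPfister m a ∈ A → onesPfister m b ∈ A →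
        onesPfister m a ≠ onesPfister m b →
        n - m + 1 < finrank (ZMod 2)
          ↥(Submodule.span (ZMod 2) (Set.range fun i => plusMinusClass m (a i)) ⊔
            Submodule.span (ZMod 2) (Set.range fun i => plusMinusClass m (b i))) := by
  have : Finite (PlusMinusSpace F m) := Finite.of_surjective _ (projPlusMinus_surjective m)
  have : Module.Finite (ZMod 2) (PlusMinusSpace F m) := Module.Finite.of_finite
  let p : ℕ → Prop := fun k => ∃ A : Finset (IsoClass F), (∀ c ∈ A, HasOnes n m c) ∧
    x - ∑ c ∈ A, S.val c ∈ S.onesIdeal n (m + 1) ∧ A.card = k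
  have hp : ∃ k, p k := by
    obtain ⟨A, hA, hAx⟩ := exists_finset_of_mem_onesIdeal hm hx
    exact ⟨_, A, hA, S.pow_succ_le_onesIdeal _ _ hAx, rfl⟩
  obtain ⟨A, hA, hAx, hcard⟩ := Nat.find_spec hp
  have hmin : ∀ B : Finset (IsoClass F), (∀ c ∈ B, HasOnes n m c) →
      x - ∑ c ∈ B, S.val c ∈ S.onesIdeal n (m + 1) → A.card ≤ B.card := fun B h1 h2 =>
    hcard.trans_le (Nat.find_min' hp ⟨B, h1, h2, rfl⟩)
  refine ⟨A, hA, hAx, fun c hc hmem => ?_, fun a b ha hb hab => ?_⟩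
  · have h1 := hmin (A.erase c) (fun c hc => hA c (Finset.mem_of_mem_erase hc)) (by
      convert add_mem hAx hmem using 1
      rw [← Finset.add_sum_erase A S.val hc]
      ring)
    exact absurd (Finset.card_erase_lt_of_mem hc) (not_lt.2 h1)
  · by_contra! hcon
    have hT : ∃ T : Finset (IsoClass F), (∀ c ∈ T, HasOnes n m c) ∧ T.card ≤ 1 ∧
        S.val (onesPfister m a) + S.val (onesPfister m b) - ∑ c ∈ T, S.val c ∈
          S.onesIdeal n (m + 1) := by
      rcases S.exists_val_add_val_sub_val_mem hm a b hcon with h | ⟨c, h⟩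
      · exact ⟨∅, by simp, by simp, by simpa using h⟩
      · exact ⟨{onesPfister m c}, by simpa using hasOnes_onesPfister hm c, by simp,
          by simpa using h⟩
    obtain ⟨T, hT, hT1, hTx⟩ := hT
    have hb' : onesPfister m b ∈ A.erase (onesPfister m a) := Finset.mem_erase.2 ⟨hab.symm, hb⟩
    -- The replacing class may already occur in `A`; `exists_finset_add` then cancels it, which only
    -- shortens the set.
    obtain ⟨B, hB, hBc, hBx⟩ := exists_finset_add (S := S)
      (P := (A.erase (onesPfister m a)).erase (onesPfister m b)) (Q := T)
      (fun c hc => hA c (Finset.mem_of_mem_erase (Finset.mem_of_mem_erase hc))) hT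
    have h1 := hmin B hB (by
      convert add_mem (add_mem hAx hTx) (S.pow_succ_le_onesIdeal n (m + 1) hBx) using 1
      rw [← Finset.add_sum_erase A S.val ha, ← Finset.add_sum_erase _ S.val hb']
      ring)
    have h2 := Finset.card_erase_of_mem ha
    have h3 := Finset.card_erase_of_mem hb'
    have h4 := Finset.card_pos.2 ⟨_, ha⟩
    have h5 := Finset.card_pos.2 ⟨_, hb'⟩
    omega

theorem exists_finset_bounds [Finite (SquareClassSpace F)] {n m : ℕ} (hm : m ≤ n) {x : R}
    (hx : x ∈ S.onesIdeal n m) : ∃ A : Finset (IsoClass F),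
      (∀ c ∈ A, HasOnes n m c ∧ ¬HasOnes n (m + 1) c) ∧
      x - ∑ c ∈ A, S.val c ∈ S.onesIdeal n (m + 1) ∧
      ((2 ^ m : R) = 0 → A = ∅) ∧ (dimPM F m ≤ n - m + 1 → A.card ≤ 1) ∧
      A.card * (2 ^ (finrank (ZMod 2) (SquareClassSpace F) - (n - m)) - 1) ≤
        numSubspaces F (n - m + 1) := by
  have : Finite (PlusMinusSpace F m) := Finite.of_surjective _ (projPlusMinus_surjective m)
  have : Module.Finite (ZMod 2) (PlusMinusSpace F m) := Module.Finite.of_finite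
  have : Module.Finite (ZMod 2) (SquareClassSpace F) := Module.Finite.of_finite
  obtain ⟨A, hA, hAx, hind, hlink⟩ := S.exists_minimal_finset hm hx
  have hex : ∀ c ∈ A, ∃ a : Fin (n - m) → Fˣ, c = onesPfister m a := fun c hc =>
    (hA c hc).exists_eq_onesPfister
  choose! a ha using hex
  have hfar : ∀ c ∈ A, ∀ c' ∈ A, c ≠ c' → n - m + 1 < finrank (ZMod 2)
      ↥(Submodule.span (ZMod 2) (Set.range fun i => plusMinusClass m (a c i)) ⊔
        Submodule.span (ZMod 2) (Set.range fun i => plusMinusClass m (a c' i))) := by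
    intro c hc c' hc' hne
    refine hlink (a c) (a c') ?_ ?_ ?_
    · rwa [← ha c hc]
    · rwa [← ha c' hc']
    · rwa [← ha c hc, ← ha c' hc']
  refine ⟨A, fun c hc => ⟨hA c hc, fun h => hind c hc (val_mem_onesIdeal h)⟩, hAx, fun h0 => ?_,
    fun hdim => ?_, ?_⟩
  · refine Finset.eq_empty_of_forall_notMem fun c hc => hind c hc ?_
    rw [ha c hc, val_onesPfister, h0, zero_mul]
    exact zero_mem _
  · refine Finset.card_le_one.2 fun c hc c' hc' => ?_
    by_contra hne
    exact absurd ((Submodule.finrank_le _).trans hdim) (not_le.2 (hfar c hc c' hc' hne))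
  -- The count takes place in `Fˣ/Fˣ²`: independence lifts along `projPlusMinus`, and the sum of two
  -- spans is at least as large there as its image in `Fˣ/±D_F(2^m)`.
  · refine card_mul_le_ncard_subspaces A
      (fun c => Submodule.span (ZMod 2) (Set.range fun i => squareClass (a c i))) ?_ ?_
    · intro c hc
      have h1 : LinearIndependent (ZMod 2) fun i => plusMinusClass m (a c i) := by
        by_contra h
        have h2 := S.val_onesPfister_mem_onesIdeal hm (a c) h
        rw [← ha c hc] at h2
        exact hind c hc h2
      have h2 : LinearIndependent (ZMod 2) fun i => squareClass (a c i) :=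
        LinearIndependent.of_comp (projPlusMinus m) h1
      exact (finrank_span_eq_card h2).trans (Fintype.card_fin _)
    · intro c hc c' hc' hne
      refine (hfar c hc c' hc' hne).trans_le ?_
      have hmap : ∀ b : Fin (n - m) → Fˣ,
          Submodule.span (ZMod 2) (Set.range fun i => plusMinusClass m (b i)) =
          (Submodule.span (ZMod 2) (Set.range fun i => squareClass (b i))).map
            (projPlusMinus m) := by
        intro b
        rw [Submodule.map_span, ← Set.range_comp]
        rfl
      rw [hmap, hmap, ← Submodule.map_sup]
      exact Submodule.finrank_map_le _ _

open scoped Classical in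
-- The remainder of each level is expanded at the next. A member of `P_{n,m}(F)` does not come from
-- a level below `m`, whose classes cannot be written with `m` ones, nor from one above, whose
-- classes can be written with `m + 1` ones.
theorem exists_finset_bounds_lt [Finite (SquareClassSpace F)] {n : ℕ} {x : R}
    (hx : x ∈ S.ideal ^ n) (j : ℕ) (hj : j ≤ n + 1) : ∃ P : Finset (IsoClass F),
      (∀ c ∈ P, HasOnes n 0 c ∧ ¬HasOnes n j c) ∧
      x - ∑ c ∈ P, S.val c ∈ S.onesIdeal n j ∧ ∀ m < j, ∃ A : Finset (IsoClass F),
        (P : Set (IsoClass F)) ∩ pfisterClassesWithOnes F n m ⊆ A ∧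
        ((2 ^ m : R) = 0 → A = ∅) ∧ (dimPM F m ≤ n - m + 1 → A.card ≤ 1) ∧
        A.card * (2 ^ (finrank (ZMod 2) (SquareClassSpace F) - (n - m)) - 1) ≤
          numSubspaces F (n - m + 1) := by
  induction j with
  | zero => exact ⟨∅, by simp, by simpa [onesIdeal_zero] using hx, by simp⟩
  | succ j ih =>
    obtain ⟨P, hP, hPx, hb⟩ := ih (by omega)
    obtain ⟨A, hA, hAx, hAb⟩ := S.exists_finset_bounds (by omega) hPx
    have hdisj : Disjoint P A := Finset.disjoint_left.2 fun c h1 h2 => (hP c h1).2 (hA c h2).1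
    refine ⟨P ∪ A, fun c hc => ?_, ?_, fun m hmj => ?_⟩
    · rcases Finset.mem_union.1 hc with h | h
      · exact ⟨(hP c h).1, fun h1 => (hP c h).2 (h1.mono (Nat.le_succ j))⟩
      · exact ⟨(hA c h).1.mono (Nat.zero_le j), (hA c h).2⟩
    · rw [Finset.sum_union hdisj, ← sub_sub]
      exact hAx
    · rcases Nat.lt_succ_iff_lt_or_eq.1 hmj with hlt | rfl
      · obtain ⟨B, hB, hBb⟩ := hb m hlt
        refine ⟨B, fun c hc => ?_, hBb⟩
        rcases Finset.mem_union.1 hc.1 with h | h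
        · exact hB ⟨h, hc.2⟩
        · exact absurd ((hA c h).1.mono hlt) hc.2.2.2
      · refine ⟨A, fun c hc => ?_, hAb⟩
        rcases Finset.mem_union.1 hc.1 with h | h
        · exact absurd hc.2.2.1 (hP c h).2
        · exact h

theorem exists_pfister_sum {d s n : ℕ} (hd : Nat.card (Fˣ ⧸ squares F) = 2 ^ d)
    (hs : pythagorasNumber F < (2 : ℕ∞) ^ (s + 1)) {x : R} (hx : x ∈ S.ideal ^ n) :
    ∃ P : Finset (IsoClass F), (P : Set (IsoClass F)) ⊆ pfisterClasses F n ∧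
      x - ∑ c ∈ P, S.val c ∈ S.ideal ^ (n + 1) ∧ ∀ m ≤ n,
        (IsSumSq (-1 : F) → s < m →
          ((P : Set (IsoClass F)) ∩ pfisterClassesWithOnes F n m).ncard = 0) ∧
        (dimPM F m ≤ n - m + 1 →
          ((P : Set (IsoClass F)) ∩ pfisterClassesWithOnes F n m).ncard ≤ 1) ∧
        (n - m + 1 < dimPM F m →
          ((P : Set (IsoClass F)) ∩ pfisterClassesWithOnes F n m).ncard ≤
              numSubspaces F (n - m + 1) / (2 ^ (d - (n - m)) - 1) ∧
          numSubspaces F (n - m + 1) / (2 ^ (d - (n - m)) - 1) ≤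
            2 ^ ((n - m + 1) * (d - (n - m))) / (2 ^ (d - (n - m)) - 1)) := by
  have hfin : Finite (SquareClassSpace F) := Nat.finite_of_card_ne_zero (hd ▸ by positivity)
  have : Module.Finite (ZMod 2) (SquareClassSpace F) := Module.Finite.of_finite
  have hdim : finrank (ZMod 2) (SquareClassSpace F) = d := by
    have h1 := Module.natCard_eq_pow_finrank (K := ZMod 2) (V := SquareClassSpace F)
    rw [Nat.card_zmod] at h1
    exact Nat.pow_right_injective le_rfl (h1.symm.trans hd)
  obtain ⟨P, hP, hPx, hb⟩ := S.exists_finset_bounds_lt hx (n + 1) le_rfl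
  rw [onesIdeal_succ_self] at hPx
  refine ⟨P, fun c hc => (hP c hc).1.mem_pfisterClasses, hPx, fun m hm => ?_⟩
  obtain ⟨A, hA, h0, h1, h2⟩ := hb m (by omega)
  rw [hdim] at h2
  have hcard : ((P : Set (IsoClass F)) ∩ pfisterClassesWithOnes F n m).ncard ≤ A.card := by
    rw [← Set.ncard_coe_finset]
    exact Set.ncard_le_ncard hA A.finite_toSet
  refine ⟨fun hF hsm => ?_, fun h => hcard.trans (h1 h), fun h => ⟨?_, ?_⟩⟩
  · have h3 : (2 ^ m : R) = 0 :=
      pow_eq_zero_of_le hsm (S.two_pow_eq_zero_of_isSumSq_neg_one hs hF)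
    rw [h0 h3] at hcard
    simpa using hcard
  · have h3 := h.trans_le ((dimPM_le m).trans hdim.le)
    refine (Nat.le_div_iff_mul_le ?_).2 ((Nat.mul_le_mul_right _ hcard).trans h2)
    exact Nat.sub_pos_of_lt (Nat.one_lt_two_pow (by omega))
  · have h3 := h.trans_le ((dimPM_le m).trans hdim.le)
    have h4 := ncard_subspaces_le (V := SquareClassSpace F) (hdim.symm ▸ h3.le)
    rw [hdim, show d - (n - m + 1) + 1 = d - (n - m) by omega] at h4
    exact Nat.div_le_div_right h4

end WittSystem

/-! ### The Witt ring as an instance, and the main theorem. -/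

/-- A quotient of the group ring `ℤ[Fˣ]` in which isometric forms are identified and the hyperbolic
plane vanishes. -/
noncomputable def WittSystem.ofRingHom {F A : Type*} [Field F] [CommRing A]
    (f : MonoidAlgebra ℤ Fˣ →+* A) (hf : Function.Surjective f) (val : IsoClass F → A)
    (hval : ∀ a, val (isoClass a) = f (formal a)) (hneg : f (formal [1, -1]) = 0) :
    WittSystem F A where
  unary := (f : MonoidAlgebra ℤ Fˣ →* A).comp (MonoidAlgebra.of ℤ Fˣ)
  val := val
  val_isoClass a := by
    rw [hval, formal, map_list_sum, List.map_map]
    rfl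
  unary_neg_one := by
    have h1 : formal [1, -1] = (1 : MonoidAlgebra ℤ Fˣ) + MonoidAlgebra.of ℤ Fˣ (-1) := by
      simp [formal, MonoidAlgebra.one_def]
    rw [h1, map_add, map_one] at hneg
    exact (neg_eq_of_add_eq_zero_right hneg).symm
  closure_range := by
    refine eq_top_iff.2 fun x _ => ?_
    obtain ⟨y, rfl⟩ := hf x
    induction y using MonoidAlgebra.induction_on with
    | of a => exact AddSubgroup.subset_closure ⟨a, rfl⟩
    | add y z hy hz =>
      rw [map_add]
      exact add_mem (hy trivial) (hz trivial)
    | smul k y hy =>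
      rw [map_zsmul]
      exact AddSubgroup.zsmul_mem _ (hy trivial) k

theorem mk_hyperbolic_plane (F : Type*) [Field F] :
    Ideal.Quotient.mk (wittRelations F) (formal [1, -1]) = 0 :=
  Ideal.Quotient.eq_zero_iff_mem.2 (Ideal.subset_span (Or.inr rfl))

/-- The Witt ring itself. -/
noncomputable def wittRingSystem (F : Type*) [Field F] : WittSystem F (WittRing F) :=
  WittSystem.ofRingHom (Ideal.Quotient.mk (wittRelations F)) Ideal.Quotient.mk_surjective
    IsoClass.witt (fun _ => rfl) (mk_hyperbolic_plane F)

/-- A form is congruent to its dimension modulo `S.ideal`, which contains `2`; conversely `1 - ⟨a⟩`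
is the class of the binary form `⟨1, -a⟩`. -/
theorem WittSystem.span_even_eq {F R : Type*} [Field F] [CommRing R] (S : WittSystem F R) :
    Ideal.span {w | ∃ a : List Fˣ, Even a.length ∧ w = S.val (isoClass a)} = S.ideal := by
  refine le_antisymm (Ideal.span_le.2 ?_) (Ideal.span_le.2 ?_)
  · rintro _ ⟨a, ha, rfl⟩
    rw [S.val_isoClass]
    have h : (a.length : R) - (a.map S.unary).sum ∈ S.ideal := by
      clear ha
      induction a with
      | nil => simp
      | cons x a ih =>
        convert add_mem ih (S.one_sub_unary_mem x) using 1
        simp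
        ring
    obtain ⟨k, hk⟩ := ha
    rw [hk] at h
    have h2 := sub_mem (Ideal.mul_mem_left _ (k : R) S.two_mem) h
    rw [show (k : R) * 2 - (((k + k : ℕ) : R) - (a.map S.unary).sum) = (a.map S.unary).sum by
      push_cast; ring] at h2
    exact h2
  · rintro _ ⟨a, rfl⟩
    refine Ideal.subset_span ⟨[1, -a], by simp, ?_⟩
    simp [S.val_isoClass, S.unary_neg, sub_eq_add_neg]

theorem fundamentalIdeal_eq (F : Type*) [Field F] :
    fundamentalIdeal F = (wittRingSystem F).ideal :=
  (wittRingSystem F).span_even_eq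

end SymbolLength

theorem mainTheorem3 {F : Type*} [Field F] (h2 : (2 : F) ≠ 0) (d s n : ℕ) (hn : 1 ≤ n)
    (hd : Nat.card (Fˣ ⧸ SymbolLength.squares F) = 2 ^ d)
    (hs : (2 : ℕ∞) ^ s ≤ SymbolLength.pythagorasNumber F)
    (hs' : SymbolLength.pythagorasNumber F < (2 : ℕ∞) ^ (s + 1))
    (φ : SymbolLength.WittRing F) (hφ : φ ∈ SymbolLength.fundamentalIdeal F ^ n) :
    ∃ P : Finset (SymbolLength.IsoClass F),
      (P : Set (SymbolLength.IsoClass F)) ⊆ SymbolLength.pfisterClasses F n ∧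
      φ - ∑ π ∈ P, π.witt ∈ SymbolLength.fundamentalIdeal F ^ (n + 1) ∧
      ∀ m : ℕ, m ≤ n →
        -- `F` nonreal and `m > s`
        (IsSumSq (-1 : F) → s < m →
          ((P : Set (SymbolLength.IsoClass F)) ∩
            SymbolLength.pfisterClassesWithOnes F n m).ncard = 0) ∧
        -- `n - m ≥ d_m - 1`
        ((IsSumSq (-1 : F) → m ≤ s) → SymbolLength.dimPM F m ≤ (n - m) + 1 →
          ((P : Set (SymbolLength.IsoClass F)) ∩
            SymbolLength.pfisterClassesWithOnes F n m).ncard ≤ 1) ∧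
        -- all other cases; here `n - m + 2 ≤ d`, and `/` is division rounded down
        ((IsSumSq (-1 : F) → m ≤ s) → (n - m) + 1 < SymbolLength.dimPM F m →
          ((P : Set (SymbolLength.IsoClass F)) ∩
            SymbolLength.pfisterClassesWithOnes F n m).ncard ≤
              SymbolLength.numSubspaces F (n - m + 1) / (2 ^ (d - (n - m)) - 1) ∧
          SymbolLength.numSubspaces F (n - m + 1) / (2 ^ (d - (n - m)) - 1) ≤
            2 ^ ((n - m + 1) * (d - (n - m))) / (2 ^ (d - (n - m)) - 1)) := by
  rw [SymbolLength.fundamentalIdeal_eq] at hφ ⊢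
  obtain ⟨P, hP, hPφ, h⟩ := (SymbolLength.wittRingSystem F).exists_pfister_sum hd hs' hφ
  exact ⟨P, hP, hPφ, fun m hm => ⟨(h m hm).1, fun _ => (h m hm).2.1, fun _ => (h m hm).2.2⟩⟩
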